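/- All matroids are finite. For a matroid $M$ with ground set $E$, rank function $r$ and rank $r(M)=r(E)$: $M$ is *connected* if any two distinct elements of $E$ lie in a common circuit, and *uniform* if for some $k$ its bases are exactly the $k$-element subsets of $E$. A flat $F$ is *proper* if $0<r(F)<r(M)$; a set is *cyclic* if it is a (possibly empty) union of circuits. Split matroids. The faces of a polytope $P\subseteq\mathbb{R}^E$ include $\emptyset$ and $P$; a facet is a maximal face among those different from $P$; the relative interior of $P$ is the set of points of $P$ in no face other than $P$. A *split* of $P$ is a collection $\mathcal{C}$ of polytopes with union $P$ such that $\emptyset\in\mathcal{C}$, every vertex of a member of $\mathcal{C}$ is a vertex of $P$, every face of a member is a member, the intersection of two distinct members is a face of both, and $\mathcal{C}$ has exactly two inclusion-maximal members; the affine span of the intersection of these two members is called a *split hyperplane* of $P$. Let $P(M)\subseteq\mathbb{R}^E$ be the convex hull of the characteristic vectors of the bases of $M$, let $\Delta$ be the convex hull of the $0,1$-vectors in $\mathbb{R}^E$ with exactly $r(M)$ ones, and for a flat $F$ let $H(F)=\{x\in\mathbb{R}^E : \sum_{i\in F}x_i=r(F)\}$. A flat $F$ is a *flacet* of $M$ if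 $H(F)\cap P(M)$ is a facet of $P(M)$ and $F$ is inclusion-minimal among the flats that cut out this same facet; it is a *split flacet* if in addition the affine span of $H(F)\cap\Delta$ is a split hyperplane of $\Delta$. The matroid $M$ is *split* if, for any two distinct split flacets $F_1,F_2$ of $M$, no point of $H(F_1)\cap H(F_2)$ lies in the relative interior of $A\cap[0,1]^E$, where $A$ is the affine span of $P(M)$. **Proposition.** Let $M$ be a connected matroid that is not split. Then there is $M'\in\{M,M^{*}\}$ such that $M'$ has a proper cyclic flat $Z$ for which the restriction $M'|Z$ is connected and non-uniform. -/

import Mathlib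

namespace SplitMatroid

section Polytopes

variable {V : Type*} [AddCommGroup V] [Module ℝ V] [TopologicalSpace V]

/-- A polytope is the convex hull of a finite set of points (the empty set is a polytope). -/
def IsPolytope (P : Set V) : Prop :=
  ∃ X : Set V, X.Finite ∧ P = convexHull ℝ X

/-- `Q` is a face of `P`: it is empty, or it is the set of all maximisers over `P` of some linear
functional. The functional `0` gives `P` itself; any other non-empty face is the intersection of
`P` with a hyperplane that has `P` on one side. -/
def IsFace (P Q : Set V) : Prop :=
  IsExposed ℝ P Q

/-- A facet is a face for which the only face that properly contains it is `P`. -/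
def IsFacet (P Q : Set V) : Prop :=
  IsFace P Q ∧ Q ≠ P ∧ ∀ R : Set V, IsFace P R → Q ⊂ R → R = P

/-- The relative interior of a polytope: the points in no face other than the polytope itself. -/
def relInterior (P : Set V) : Set V :=
  {x | x ∈ P ∧ ∀ Q : Set V, IsFace P Q → x ∈ Q → Q = P}

/-- A split of a polytope `P`: a polytopal subdivision of `P` without new vertices that has exactly
two maximal cells. The vertices of a polytope are its exposed points. -/
structure IsSplitOf (P : Set V) (C : Set (Set V)) : Prop where
  isPolytope : ∀ Q ∈ C, IsPolytope Q
  empty_mem : ∅ ∈ C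
  vertices : ∀ Q ∈ C, Q.exposedPoints ℝ ⊆ P.exposedPoints ℝ
  face_mem : ∀ Q ∈ C, ∀ R : Set V, IsFace Q R → R ∈ C
  inter_face : ∀ Q₁ ∈ C, ∀ Q₂ ∈ C, Q₁ ≠ Q₂ → IsFace Q₁ (Q₁ ∩ Q₂) ∧ IsFace Q₂ (Q₁ ∩ Q₂)
  sUnion_eq : ⋃₀ C = P
  two_maximal : {Q : Set V | Maximal (fun R => R ∈ C) Q}.ncard = 2

/-- A split hyperplane of `P`: the affine span of the intersection of the two maximal cells of
a split of `P`. -/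
def IsSplitHyperplane (P : Set V) (S : AffineSubspace ℝ V) : Prop :=
  ∃ C : Set (Set V), IsSplitOf P C ∧
    ∃ Q₁ Q₂ : Set V, Maximal (fun R => R ∈ C) Q₁ ∧ Maximal (fun R => R ∈ C) Q₂ ∧ Q₁ ≠ Q₂ ∧
      S = affineSpan ℝ (Q₁ ∩ Q₂)

end Polytopes

/-- The characteristic vector of a set. -/
noncomputable def charVec {ι : Type*} (S : Set ι) : ι → ℝ :=
  S.indicator 1

/-- The hypersimplex: the convex hull of the `0,1`-vectors with exactly `r` ones. -/
def hypersimplex (ι : Type*) (r : ℕ) : Set (ι → ℝ) :=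
  convexHull ℝ (charVec '' {S : Set ι | S.encard = (r : ℕ∞)})

section Matroids

variable {α : Type*}

/-- The rank of a set, as a natural number (used for finite matroids). -/
noncomputable def rk (M : Matroid α) (X : Set α) : ℕ :=
  (M.eRk X).toNat

/-- A matroid is connected if any two distinct elements lie in a common circuit. -/
def IsConnected (M : Matroid α) : Prop :=
  ∀ e ∈ M.E, ∀ f ∈ M.E, e ≠ f → ∃ C : Set α, M.IsCircuit C ∧ e ∈ C ∧ f ∈ C

/-- A matroid is uniform if, for some `r`, its bases are exactly the `r`-element subsets of the
ground set. -/
def IsUniform (M : Matroid α) : Prop :=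
  ∃ r : ℕ, ∀ B : Set α, M.IsBase B ↔ B ⊆ M.E ∧ B.encard = (r : ℕ∞)

/-- A set is cyclic if it is a (possibly empty) union of circuits. -/
def IsCyclic (M : Matroid α) (Z : Set α) : Prop :=
  ∃ S : Set (Set α), (∀ C ∈ S, M.IsCircuit C) ∧ Z = ⋃₀ S

/-- A proper cyclic flat: a cyclic flat `Z` with `0 < r(Z) < r(M)`. -/
def IsProperCyclicFlat (M : Matroid α) (Z : Set α) : Prop :=
  M.IsFlat Z ∧ IsCyclic M Z ∧ 0 < rk M Z ∧ rk M Z < rk M M.E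

/-- The matroid polytope, in the space `ℝ^E` with coordinates indexed by the ground set `E`. -/
def polytope (M : Matroid α) : Set (M.E → ℝ) :=
  convexHull ℝ (charVec '' {B : Set M.E | M.IsBase (Subtype.val '' B)})

/-- The set `H(F)` of all `x ∈ ℝ^E` with `∑_{i ∈ F} x_i = r(F)`. -/
def hyperplane (M : Matroid α) (F : Set α) : Set (M.E → ℝ) :=
  {x | ∑ᶠ i ∈ {i : M.E | (i : α) ∈ F}, x i = (rk M F : ℝ)}

/-- A flacet: a flat `F` such that `H(F)` cuts out a facet of the matroid polytope, and which is
inclusion-minimal among the flats that cut out this facet. -/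
def IsFlacet (M : Matroid α) (F : Set α) : Prop :=
  M.IsFlat F ∧ IsFacet (polytope M) (hyperplane M F ∩ polytope M) ∧
    ∀ G : Set α, M.IsFlat G → G ⊆ F →
      hyperplane M G ∩ polytope M = hyperplane M F ∩ polytope M → G = F

/-- A split flacet: a flacet `F` such that `H(F) ∩ Δ(r,n)` spans a split hyperplane of the
hypersimplex `Δ(r,n)`, where `r` is the rank of the matroid. -/
def IsSplitFlacet (M : Matroid α) (F : Set α) : Prop :=
  IsFlacet M F ∧
    IsSplitHyperplane (hypersimplex M.E (rk M M.E))
      (affineSpan ℝ (hyperplane M F ∩ hypersimplex M.E (rk M M.E)))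

/-- A matroid is split if, for any two distinct split flacets `F₁` and `F₂`, no point of
`H(F₁) ∩ H(F₂)` is in the relative interior of `A ∩ [0,1]^E`, where `A` is the affine span of the
matroid polytope. -/
def IsSplit (M : Matroid α) : Prop :=
  ∀ F₁ F₂ : Set α, IsSplitFlacet M F₁ → IsSplitFlacet M F₂ → F₁ ≠ F₂ →
    ∀ x ∈ hyperplane M F₁ ∩ hyperplane M F₂,
      x ∉ relInterior ((affineSpan ℝ (polytope M) : Set (M.E → ℝ)) ∩ Set.Icc 0 1)

end Matroids

end SplitMatroid

/-! Suppose that all connected restrictions of M and M* to proper cyclic flats are uniform, and let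
x be a point that violates splitness for split flacets F₁ ≠ F₂. Its coordinates lie strictly between
0 and 1, and x(E) = r(M).

For a flacet F of a connected matroid, M|F and M/F are connected; the latter is expressed through
its dual M*|(E \ F). A split flacet is not a singleton, so F and E \ F are proper cyclic flats of M
and M*, and both restrictions are uniform by assumption.

F₁ is dependent, so uniformity of M|F₂ excludes F₁ ⊆ F₂. Hence F₁ ∩ F₂ has smaller rank than F₁ and,
by uniformity of M|F₁, is independent. Uniformity of M/F₁ and dependence of F₂ then give r(F₁ ∪ F₂)
= r(M). Submodularity yields |F₁ ∩ F₂| + r(M) ≤ r(F₁) + r(F₂) = x(F₁ ∩ F₂) + x(F₁ ∪ F₂). As 0 < xᵢ <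
1, this fails unless F₁ and F₂ are complementary, and then r(F₁) + r(F₂) = r(M) contradicts
connectivity (`false_of_isUniform_of_not_subset`). -/

open Set

namespace SplitMatroid

/-! ### Natural-number rank function -/

section Rank

variable {α : Type*} {M : Matroid α} {X Y : Set α}

lemma cast_rk (M : Matroid α) [M.RankFinite] (X : Set α) : (rk M X : ℕ∞) = M.eRk X :=
  ENat.natCast_toNat (Matroid.eRk_ne_top_iff.2 (M.isRkFinite_set X))

lemma rk_mono (M : Matroid α) [M.RankFinite] (h : X ⊆ Y) : rk M X ≤ rk M Y := by
  have := M.eRk_mono h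
  rw [← cast_rk, ← cast_rk] at this
  exact_mod_cast this

lemma rk_inter_add_rk_union_le (M : Matroid α) [M.RankFinite] (X Y : Set α) :
    rk M (X ∩ Y) + rk M (X ∪ Y) ≤ rk M X + rk M Y := by
  have := M.eRk_inter_add_eRk_union_le X Y
  simp only [← cast_rk] at this
  exact_mod_cast this

@[simp] lemma rk_empty (M : Matroid α) : rk M ∅ = 0 := by simp [rk]

lemma rk_union_le (M : Matroid α) [M.RankFinite] (X Y : Set α) :
    rk M (X ∪ Y) ≤ rk M X + rk M Y := by
  have := rk_inter_add_rk_union_le M X Y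
  omega

lemma cast_ncard_of_subset_ground [M.Finite] (h : X ⊆ M.E) : (X.ncard : ℕ∞) = X.encard :=
  (M.ground_finite.subset h).cast_ncard_eq

lemma rk_le_ncard [M.Finite] (h : X ⊆ M.E) : rk M X ≤ X.ncard := by
  have := M.eRk_le_encard X
  rw [← cast_rk, ← cast_ncard_of_subset_ground h] at this
  exact_mod_cast this

lemma rk_eq_ncard_of_indep [M.Finite] (h : M.Indep X) : rk M X = X.ncard := by
  have := h.eRk_eq_encard
  rw [← cast_rk, ← cast_ncard_of_subset_ground h.subset_ground] at this
  exact_mod_cast this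

lemma indep_of_ncard_le_rk [M.Finite] (hX : X ⊆ M.E) (h : X.ncard ≤ rk M X) : M.Indep X := by
  rw [Matroid.indep_iff_eRk_eq_encard, ← cast_rk, ← cast_ncard_of_subset_ground hX,
    le_antisymm (rk_le_ncard hX) h]

lemma rk_restrict (M : Matroid α) (h : X ⊆ Y) : rk (M.restrict Y) X = rk M X := by
  rw [rk, rk, Matroid.restrict_eRk_eq M h]

lemma ncard_eq_rk_of_isBasis [M.Finite] (h : M.IsBasis X Y) : X.ncard = rk M Y := by
  have := h.encard_eq_eRk
  rw [← cast_rk, ← cast_ncard_of_subset_ground (h.subset.trans h.subset_ground)] at this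
  exact_mod_cast this

lemma rk_dual_add_rk_ground [M.Finite] (h : X ⊆ M.E) :
    rk M.dual X + rk M M.E = rk M (M.E \ X) + X.ncard := by
  have := M.eRk_dual_add_eRank X h
  rw [← M.eRk_ground, ← cast_rk, ← cast_rk, ← cast_rk, ← cast_ncard_of_subset_ground h] at this
  exact_mod_cast this

lemma ncard_inter_le_rk [M.Finite] {B : Set α} (hB : M.IsBase B) (X : Set α) :
    (B ∩ X).ncard ≤ rk M X := by
  rw [← rk_eq_ncard_of_indep (hB.indep.subset inter_subset_left)]
  exact rk_mono M inter_subset_right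

/-- Extend a basis of X to one of Y and then to a base. This supplies vertices of P(M) on H(X) and
H(Y) at once. -/
lemma exists_isBase_ncard_inter_eq [M.Finite] (hXY : X ⊆ Y) (hY : Y ⊆ M.E) :
    ∃ B, M.IsBase B ∧ (B ∩ X).ncard = rk M X ∧ (B ∩ Y).ncard = rk M Y := by
  obtain ⟨I, hI⟩ := M.exists_isBasis X (hXY.trans hY)
  obtain ⟨J, hJ, hIJ⟩ := hI.indep.subset_isBasis_of_subset (hI.subset.trans hXY) hY
  obtain ⟨B, hB, hJB⟩ := hJ.indep.exists_isBase_superset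
  have key : ∀ {K Z : Set α}, M.IsBasis K Z → K ⊆ B → (B ∩ Z).ncard = rk M Z := by
    intro K Z hK hKB
    refine le_antisymm (ncard_inter_le_rk hB Z) ?_
    rw [← ncard_eq_rk_of_isBasis hK]
    exact ncard_le_ncard (subset_inter hKB hK.subset)
      (M.ground_finite.subset (inter_subset_left.trans hB.subset_ground))
  exact ⟨B, hB, key hI (hIJ.trans hJB), key hJ hJB⟩

lemma subset_of_rk_le [M.RankFinite] {F : Set α} (hF : M.IsFlat F) (hXF : X ⊆ F) (hXY : X ⊆ Y)
    (hY : Y ⊆ M.E) (h : rk M Y ≤ rk M X) : Y ⊆ F := by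
  have h' : M.eRk Y ≤ M.eRk X := by
    rw [← cast_rk, ← cast_rk]
    exact_mod_cast h
  have := (M.isRkFinite_set X).closure_eq_closure_of_subset_of_eRk_ge_eRk hXY h'
  exact ((M.subset_closure Y hY).trans this.superset).trans
    ((M.closure_subset_closure hXF).trans hF.closure.subset)

lemma rk_lt_rk_ground [M.RankFinite] (hX : M.IsFlat X) (hne : X ≠ M.E) : rk M X < rk M M.E := by
  by_contra! h
  exact hne (hX.subset_ground.antisymm
    (subset_of_rk_le hX subset_rfl hX.subset_ground subset_rfl h))

/-- The rank function of a uniform restriction. -/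
lemma rk_eq_min_of_isUniform [M.Finite] (hY : Y ⊆ M.E) (hu : IsUniform (M.restrict Y))
    (hXY : X ⊆ Y) : rk M X = min X.ncard (rk M Y) := by
  obtain ⟨k, hk⟩ := hu
  have hYfin := M.ground_finite.subset hY
  obtain ⟨B, hB⟩ := (M.restrict Y).exists_isBase
  have hBY : B ⊆ Y := hB.subset_ground
  have hrk : ∀ S ⊆ Y, S.ncard = k → M.Indep S := by
    intro S hS hSk
    have : (M.restrict Y).IsBase S := (hk S).2 ⟨hS, by
      rw [← cast_ncard_of_subset_ground (hS.trans hY), hSk]⟩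
    exact this.indep.of_restrict
  have hBk : B.ncard = k := by
    have := ((hk B).1 hB).2
    rw [← cast_ncard_of_subset_ground (hBY.trans hY)] at this
    exact_mod_cast this
  have hYk : rk M Y = k := by
    rw [Matroid.isBase_restrict_iff hY] at hB
    rw [← ncard_eq_rk_of_isBasis hB, hBk]
  have hkY : k ≤ Y.ncard := hBk ▸ ncard_le_ncard hBY hYfin
  refine le_antisymm (le_min (rk_le_ncard (hXY.trans hY)) (rk_mono M hXY)) ?_
  rw [hYk]
  rcases le_total X.ncard k with h | h
  · obtain ⟨S, hXS, hSY, hS⟩ := exists_subsuperset_card_eq hXY h hkY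
    rw [rk_eq_ncard_of_indep ((hrk S hSY hS).subset hXS)]
    exact min_le_left _ _
  · obtain ⟨S, hSX, hS⟩ := exists_subset_card_eq h
    have := rk_mono M hSX
    rw [rk_eq_ncard_of_indep (hrk S (hSX.trans hXY) hS), hS] at this
    exact (min_le_right _ _).trans this

end Rank

/-! ### Circuits, separators and connectivity -/

section Connectivity

variable {α : Type*} {M : Matroid α} {Z : Set α}

/-- Lying in a common circuit is a transitive relation. -/
lemma exists_isCircuit_of_inter_nonempty [M.Finite] {e g : α} :
    ∀ (n : ℕ) (C₁ C₂ : Set α), (C₁ ∪ C₂).ncard = n → M.IsCircuit C₁ → M.IsCircuit C₂ →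
      e ∈ C₁ → g ∈ C₂ → (C₁ ∩ C₂).Nonempty → ∃ C, M.IsCircuit C ∧ e ∈ C ∧ g ∈ C := by
  intro n
  induction n using Nat.strong_induction_on with
  | _ n ih =>
  intro C₁ C₂ hn h₁ h₂ he hg ⟨f, hf₁, hf₂⟩
  by_contra hno
  have hg₁ : g ∉ C₁ := fun h => hno ⟨C₁, h₁, he, h⟩
  have he₂ : e ∉ C₂ := fun h => hno ⟨C₂, h₂, h, hg⟩
  have hfin : (C₁ ∪ C₂).Finite :=
    M.ground_finite.subset (union_subset h₁.subset_ground h₂.subset_ground)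
  -- In a counterexample with minimal union, no other pair of this kind has a smaller union.
  -- Eliminating f while keeping e gives C₃, and while keeping g gives C₄; the pair C₃, C₄ then has
  -- a union that misses f.
  have hmin : ∀ D₁ D₂ : Set α, M.IsCircuit D₁ → M.IsCircuit D₂ → e ∈ D₁ → g ∈ D₂ →
      (D₁ ∩ D₂).Nonempty → D₁ ∪ D₂ ⊆ C₁ ∪ C₂ → D₁ ∪ D₂ = C₁ ∪ C₂ := by
    intro D₁ D₂ hD₁ hD₂ h1 h2 hne hss
    by_contra hne'
    exact hno (ih _ (hn ▸ ncard_lt_ncard (hss.ssubset_of_ne hne') hfin) D₁ D₂ rfl hD₁ hD₂ h1 h2 hne)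
  obtain ⟨C₃, hC₃, h₃, he₃⟩ := h₁.strong_elimination h₂ hf₁ hf₂ he he₂
  obtain ⟨C₄, hC₄, h₄, hg₄⟩ := h₂.strong_elimination h₁ hf₂ hf₁ hg hg₁
  rw [union_comm] at hC₄
  have h₃₂ : (C₃ ∩ C₂).Nonempty := by
    rw [nonempty_iff_ne_empty]
    intro h0
    have hss : C₃ ⊆ C₁ := fun y hy => (hC₃ hy).1.resolve_right fun h =>
      eq_empty_iff_forall_notMem.1 h0 y ⟨hy, h⟩
    exact (hC₃ (h₃.eq_of_subset_isCircuit h₁ hss ▸ hf₁)).2 rfl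
  have hU := hmin C₃ C₂ h₃ h₂ he₃ hg h₃₂
    (union_subset (hC₃.trans sdiff_subset) subset_union_right)
  have h₃₄ : (C₃ ∩ C₄).Nonempty := by
    rw [nonempty_iff_ne_empty]
    intro h0
    have hss : C₄ ⊆ C₂ := by
      intro y hy
      have : y ∈ C₃ ∪ C₂ := hU ▸ (hC₄ hy).1
      exact this.resolve_left fun h => eq_empty_iff_forall_notMem.1 h0 y ⟨h, hy⟩
    exact (hC₄ (h₄.eq_of_subset_isCircuit h₂ hss ▸ hf₂)).2 rfl
  have hU' := hmin C₃ C₄ h₃ h₄ he₃ hg₄ h₃₄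
    (union_subset (hC₃.trans sdiff_subset) (hC₄.trans sdiff_subset))
  have hf : f ∈ C₃ ∪ C₄ := hU' ▸ Or.inl hf₁
  rcases hf with h | h
  · exact (hC₃ h).2 rfl
  · exact (hC₄ h).2 rfl

/-- A finite matroid is connected if and only if it has no proper non-empty separator. -/
lemma isConnected_iff [M.Finite] : IsConnected M ↔ ∀ S ⊆ M.E, S.Nonempty → (M.E \ S).Nonempty →
    rk M M.E < rk M S + rk M (M.E \ S) := by
  constructor
  · rintro hc S hS ⟨e, he⟩ ⟨f, hf⟩
    by_contra hle
    obtain ⟨C, hC, heC, hfC⟩ := hc e (hS he) f hf.1 (fun h => hf.2 (h ▸ he))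
    -- The two parts of C are independent and extend to bases of S and E \ S. If rank were additive,
    -- the union of these bases would be independent and contain C.
    have h1 : M.Indep (C ∩ S) :=
      hC.ssubset_indep (inter_subset_left.ssubset_of_mem_notMem hfC fun h => hf.2 h.2)
    have h2 : M.Indep (C \ S) :=
      hC.ssubset_indep (sdiff_subset.ssubset_of_mem_notMem heC fun h => h.2 he)
    obtain ⟨I, hI, hCI⟩ := h1.subset_isBasis_of_subset inter_subset_right hS
    obtain ⟨J, hJ, hCJ⟩ := h2.subset_isBasis_of_subset
      (sdiff_subset_sdiff_left hC.subset_ground) sdiff_subset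
    have hIJ : I ∪ J ⊆ M.E := union_subset hI.indep.subset_ground hJ.indep.subset_ground
    have hcl : M.eRk (I ∪ J) = M.eRk M.E := by
      rw [hI.eRk_eq_eRk_union J, union_comm, hJ.eRk_eq_eRk_union S, sdiff_union_of_subset hS]
    have hind : M.Indep (I ∪ J) := by
      refine indep_of_ncard_le_rk hIJ ?_
      have h3 : rk M (I ∪ J) = rk M M.E := by rw [rk, rk, hcl]
      have h4 := ncard_union_le I J
      rw [ncard_eq_rk_of_isBasis hI, ncard_eq_rk_of_isBasis hJ] at h4
      omega
    refine hC.not_indep (hind.subset fun y hy => ?_)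
    by_cases hyS : y ∈ S
    · exact Or.inl (hCI ⟨hy, hyS⟩)
    · exact Or.inr (hCJ ⟨hy, hyS⟩)
  · intro h e he f hf hne
    by_contra hno
    -- By transitivity, no circuit crosses the boundary of the class of e, so bases of S and its
    -- complement have an independent union. The element e is inserted in case it lies in no
    -- circuit.
    let S : Set α := insert e (⋃₀ {C | M.IsCircuit C ∧ e ∈ C})
    have hS : S ⊆ M.E := insert_subset he (sUnion_subset fun C hC => hC.1.subset_ground)
    have hfS : f ∉ S := by
      rintro (rfl | ⟨C, hC, hfC⟩)
      · exact hne rfl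
      · exact hno ⟨C, hC.1, hC.2, hfC⟩
    have hcirc : ∀ C, M.IsCircuit C → (C ∩ S).Nonempty → C ⊆ S := by
      rintro C hC ⟨y, hyC, rfl | ⟨D, hD, hyD⟩⟩ g hg
      · exact Or.inr ⟨C, ⟨hC, hyC⟩, hg⟩
      · obtain ⟨C', hC', he', hg'⟩ := exists_isCircuit_of_inter_nonempty _ D C rfl hD.1 hC hD.2 hg
          ⟨y, hyD, hyC⟩
        exact Or.inr ⟨C', ⟨hC', he'⟩, hg'⟩
    refine (h S hS ⟨e, Or.inl rfl⟩ ⟨f, hf, hfS⟩).not_ge ?_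
    obtain ⟨I, hI⟩ := M.exists_isBasis S hS
    obtain ⟨J, hJ⟩ := M.exists_isBasis (M.E \ S) sdiff_subset
    have hIJ : I ∪ J ⊆ M.E := union_subset hI.indep.subset_ground hJ.indep.subset_ground
    have hind : M.Indep (I ∪ J) := by
      rw [Matroid.indep_iff_forall_subset_not_isCircuit hIJ]
      intro C hCs hC
      by_cases hCS : (C ∩ S).Nonempty
      · refine hC.not_indep (hI.indep.subset fun y hy => (hCs hy).resolve_right fun hyJ => ?_)
        exact (hJ.subset hyJ).2 (hcirc C hC hCS hy)
      · refine hC.not_indep (hJ.indep.subset fun y hy => (hCs hy).resolve_left fun hyI => ?_)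
        exact hCS ⟨y, hy, hI.subset hyI⟩
    have hdj : Disjoint I J := disjoint_sdiff_right.mono hI.subset hJ.subset
    have h1 := ncard_union_eq hdj (M.ground_finite.subset hI.indep.subset_ground)
      (M.ground_finite.subset hJ.indep.subset_ground)
    rw [ncard_eq_rk_of_isBasis hI, ncard_eq_rk_of_isBasis hJ, ← rk_eq_ncard_of_indep hind] at h1
    rw [← h1]
    exact rk_mono M hIJ

lemma exists_isCircuit_subset_of_isConnected_restrict (hZ : Z ⊆ M.E)
    (hc : IsConnected (M.restrict Z)) (hnt : Z.Nontrivial) {e : α} (he : e ∈ Z) :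
    ∃ C ⊆ Z, M.IsCircuit C ∧ e ∈ C ∧ M.Indep {e} := by
  obtain ⟨f, hf, hne⟩ := hnt.exists_ne e
  obtain ⟨C, hC, heC, hfC⟩ := hc e he f hf hne.symm
  rw [Matroid.restrict_isCircuit_iff hZ] at hC
  refine ⟨C, hC.2, hC.1, heC, hC.1.ssubset_indep ?_⟩
  exact (singleton_subset_iff.2 heC).ssubset_of_mem_notMem hfC hne

lemma isProperCyclicFlat_of_isConnected_restrict [M.Finite] (hZ : M.IsFlat Z) (hne : Z ≠ M.E)
    (hc : IsConnected (M.restrict Z)) (hnt : Z.Nontrivial) : IsProperCyclicFlat M Z := by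
  have key := fun e he =>
    exists_isCircuit_subset_of_isConnected_restrict hZ.subset_ground hc hnt (e := e) he
  refine ⟨hZ, ⟨{C | M.IsCircuit C ∧ C ⊆ Z}, fun C hC => hC.1, ?_⟩, ?_, rk_lt_rk_ground hZ hne⟩
  · refine subset_antisymm (fun e he => ?_) (sUnion_subset fun C hC => hC.2)
    obtain ⟨C, hCZ, hC, heC, -⟩ := key e he
    exact ⟨C, ⟨hC, hCZ⟩, heC⟩
  · obtain ⟨e, he⟩ := hnt.nonempty
    obtain ⟨-, -, -, -, hi⟩ := key e he
    have := rk_mono M (singleton_subset_iff.2 he)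
    rw [rk_eq_ncard_of_indep hi, ncard_singleton] at this
    omega

/-- The complement of a cyclic set is a flat of the dual matroid. -/
lemma isFlat_dual_compl (h : ∀ e ∈ Z, ∃ C ⊆ Z, M.IsCircuit C ∧ e ∈ C) :
    M.dual.IsFlat (M.E \ Z) := by
  rw [Matroid.isFlat_iff_closure_eq]
  refine subset_antisymm (fun e he => ?_) (M.dual.subset_closure _ sdiff_subset)
  by_contra hn
  have heE : e ∈ M.E := M.dual.closure_subset_ground _ he
  have heZ : e ∈ Z := by_contra fun h => hn ⟨heE, h⟩
  obtain ⟨K, hKs, hK, heK⟩ := Matroid.exists_isCircuit_of_mem_closure he hn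
  obtain ⟨C, hCZ, hC, heC⟩ := h e heZ
  refine hC.inter_isCocircuit_ne_singleton hK (e := e) ?_
  refine subset_antisymm (fun y hy => ?_) (singleton_subset_iff.2 ⟨heC, heK⟩)
  rcases hKs hy.2 with h | h
  · exact h
  · exact absurd (hCZ hy.1) h.2

end Connectivity

/-! ### Faces, vertices and splits of polytopes -/

section Polytopes

variable {V : Type*} [AddCommGroup V] [Module ℝ V]

lemma eq_of_mem_affineSpan (l : V →ₗ[ℝ] ℝ) {s : Set V} {c : ℝ} (h : ∀ y ∈ s, l y = c) {x : V}
    (hx : x ∈ affineSpan ℝ s) : l x = c := by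
  refine affineSpan_induction hx h fun a u v w hu hv hw => ?_
  simp [hu, hv, hw]

variable [TopologicalSpace V]

lemma isFace_of_forall_le {P : Set V} (l : StrongDual ℝ V) (c : ℝ) (h : ∀ y ∈ P, l y ≤ c) :
    IsFace P {y | y ∈ P ∧ l y = c} := by
  -- `IsExposed` asks for nothing when the set is empty, so c need not be attained.
  rintro ⟨w, hw⟩
  refine ⟨l, ext fun y => ⟨fun hy => ⟨hy.1, fun z hz => (h z hz).trans_eq hy.2.symm⟩,
    fun hy => ⟨hy.1, le_antisymm (h y hy.1) ?_⟩⟩⟩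
  rw [← hw.2]
  exact hy.2 w hw.1

variable [IsTopologicalAddGroup V] [ContinuousSMul ℝ V] [T2Space V]

lemma IsPolytope.isClosed {P : Set V} (h : IsPolytope P) : IsClosed P := by
  obtain ⟨X, hX, rfl⟩ := h
  exact hX.isClosed_convexHull ℝ

/-- A polytope is the convex hull of its vertices. -/
lemma IsPolytope.eq_convexHull_exposedPoints [LocallyConvexSpace ℝ V] {P : Set V}
    (h : IsPolytope P) : P = convexHull ℝ (P.exposedPoints ℝ) := by
  obtain ⟨X, hX, rfl⟩ := h
  refine subset_antisymm ?_ (convexHull_min exposedPoints_subset (convex_convexHull ℝ X))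
  have hSfin : {Y : Set V | Y ⊆ X ∧ convexHull ℝ Y = convexHull ℝ X}.Finite :=
    hX.finite_subsets.subset fun Y hY => hY.1
  -- Each point of a minimal generating set Y lies outside the hull of the others; a functional that
  -- strictly separates it from them exposes it.
  obtain ⟨Y, -, hY⟩ := hSfin.exists_le_minimal (a := X) ⟨subset_rfl, rfl⟩
  nth_rw 1 [← hY.prop.2]
  refine convexHull_mono fun v hv => ?_
  have hvY : v ∉ convexHull ℝ (Y \ {v}) := by
    intro hmem
    have h1 : convexHull ℝ (Y \ {v}) = convexHull ℝ X := by
      rw [← hY.prop.2]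
      refine subset_antisymm (convexHull_mono sdiff_subset)
        (convexHull_min (fun y hy => ?_) (convex_convexHull ℝ _))
      by_cases hyv : y = v
      · exact hyv ▸ hmem
      · exact subset_convexHull ℝ _ ⟨hy, hyv⟩
    exact (hY.le_of_le ⟨sdiff_subset.trans hY.prop.1, h1⟩ sdiff_subset hv).2 rfl
  obtain ⟨l, u, hlu, huv⟩ := geometric_hahn_banach_closed_point (convex_convexHull ℝ (Y \ {v}))
    (((hX.subset hY.prop.1).subset sdiff_subset).isClosed_convexHull ℝ) hvY
  refine ⟨subset_convexHull ℝ X (hY.prop.1 hv), l, fun y hy => ?_⟩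
  rw [← hY.prop.2, ← insert_sdiff_self_of_mem hv] at hy
  rcases (Y \ {v}).eq_empty_or_nonempty with h0 | h0
  · have hyv : y = v := by simpa [h0] using hy
    simp [hyv]
  · rw [convexHull_insert h0, mem_convexJoin] at hy
    obtain ⟨w, rfl, z, hz, a, b, ha, hb, hab, rfl⟩ := hy
    have hzl : l z < l w := (hlu z hz).trans huv
    obtain rfl : a = 1 - b := by linarith
    simp only [map_add, map_smul, smul_eq_mul]
    refine ⟨by nlinarith, fun hle => ?_⟩
    obtain rfl : b = 0 := by nlinarith
    simp

/-- The points of P with l < c are dense in P: an open segment from any point of P to z consists of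
such points. -/
lemma subset_of_isClosed_of_lt {P Q : Set V} (hP : Convex ℝ P) (hQ : IsClosed Q)
    (l : StrongDual ℝ V) {c : ℝ} (hl : ∀ y ∈ P, l y ≤ c) (hlt : ∃ y ∈ P, l y < c)
    (h : ∀ y ∈ P, l y < c → y ∈ Q) : P ⊆ Q := by
  obtain ⟨z, hz, hzc⟩ := hlt
  intro p hp
  have hseg : openSegment ℝ p z ⊆ Q := by
    intro y hy
    refine h y (hP.openSegment_subset hp hz hy) ?_
    obtain ⟨a, b, ha, hb, hab, rfl⟩ := hy
    have := hl p hp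
    obtain rfl : a = 1 - b := by linarith
    simp only [map_add, map_smul, smul_eq_mul]
    nlinarith
  have := hQ.closure_subset_iff.2 hseg
  rw [closure_openSegment] at this
  exact this (left_mem_segment ℝ p z)

/-- A hyperplane that supports `P` does not contain the intersection of the two maximal cells of
a split of `P`. -/
lemma IsSplitOf.exists_inter_lt [LocallyConvexSpace ℝ V] {P : Set V} {C : Set (Set V)}
    (hC : IsSplitOf P C) (hP : IsPolytope P) {Q₁ Q₂ : Set V} (h₁ : Maximal (fun R => R ∈ C) Q₁)
    (h₂ : Maximal (fun R => R ∈ C) Q₂) (hne : Q₁ ≠ Q₂) (l : StrongDual ℝ V) {c : ℝ}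
    (hl : ∀ y ∈ P, l y ≤ c) (hlt : ∃ y ∈ P, l y < c) : ∃ y ∈ Q₁ ∩ Q₂, l y < c := by
  by_contra! hcon
  have hsub : ∀ Q ∈ C, Q ⊆ P := fun Q hQ => hC.sUnion_eq ▸ subset_sUnion_of_mem hQ
  have hPconv : Convex ℝ P := by
    obtain ⟨X, -, rfl⟩ := hP
    exact convex_convexHull ℝ X
  have hvert : (P.exposedPoints ℝ).Finite := by
    obtain ⟨X, hX, rfl⟩ := hP
    exact hX.subset (exposedPoints_subset_extremePoints.trans extremePoints_convexHull_subset)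
  -- A cell is determined by its vertices, which are among the finitely many vertices of P.
  -- Finiteness puts each cell inside a maximal one.
  have hfin : C.Finite := by
    refine Finite.of_finite_image (f := fun Q => Q.exposedPoints ℝ)
      (hvert.finite_subsets.subset ?_) fun Q hQ R hR hQR => ?_
    · rintro _ ⟨Q, hQ, rfl⟩
      exact hC.vertices Q hQ
    · rw [(hC.isPolytope Q hQ).eq_convexHull_exposedPoints,
        (hC.isPolytope R hR).eq_convexHull_exposedPoints]
      exact congrArg _ hQR
  have hmax : ∀ R, Maximal (fun R => R ∈ C) R → R = Q₁ ∨ R = Q₂ := by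
    intro R hR
    obtain ⟨A, B, -, hAB⟩ := ncard_eq_two.1 hC.two_maximal
    have hmem : ∀ T, Maximal (fun R => R ∈ C) T ↔ T = A ∨ T = B := fun T => by
      simpa using Set.ext_iff.1 hAB T
    rw [hmem] at h₁ h₂ hR
    rcases h₁ with rfl | rfl <;> rcases h₂ with rfl | rfl <;> tauto
  have hcov : {y | y ∈ P ∧ l y < c} ⊆ Q₁ ∪ Q₂ := by
    rintro y ⟨hy, -⟩
    rw [← hC.sUnion_eq] at hy
    obtain ⟨R, hR, hyR⟩ := hy
    obtain ⟨T, hRT, hT⟩ := hfin.exists_le_maximal hR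
    rcases hmax T hT with rfl | rfl
    · exact Or.inl (hRT hyR)
    · exact Or.inr (hRT hyR)
  have hU : Convex ℝ {y | y ∈ P ∧ l y < c} :=
    hPconv.inter (convex_halfSpace_lt l.toLinearMap.isLinear c)
  have hcl₁ := (hC.isPolytope Q₁ h₁.prop).isClosed
  have hcl₂ := (hC.isPolytope Q₂ h₂.prop).isClosed
  -- The convex set P ∩ {l < c} is covered by two closed cells that are disjoint on it. By
  -- connectedness one cell contains it, hence all of P, against maximality of the other.
  rcases isPreconnected_iff_subset_of_disjoint_closed.1 hU.isPreconnected Q₁ Q₂ hcl₁ hcl₂ hcov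
    (eq_empty_iff_forall_notMem.2 fun y hy => (hcon y hy.2).not_gt hy.1.2) with h | h
  · have hPQ := subset_of_isClosed_of_lt hPconv hcl₁ l hl hlt fun y hy hyc => h ⟨hy, hyc⟩
    exact hne (h₂.eq_of_le h₁.prop ((hsub Q₂ h₂.prop).trans hPQ)).symm
  · have hPQ := subset_of_isClosed_of_lt hPconv hcl₂ l hl hlt fun y hy hyc => h ⟨hy, hyc⟩
    exact hne (h₁.eq_of_le h₂.prop ((hsub Q₁ h₁.prop).trans hPQ))

/-- The affine span of a set in a supporting hyperplane is not a split hyperplane. -/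
lemma not_isSplitHyperplane_affineSpan [LocallyConvexSpace ℝ V] {P S : Set V} (hP : IsPolytope P)
    (l : StrongDual ℝ V) {c : ℝ} (hl : ∀ y ∈ P, l y ≤ c) (hlt : ∃ y ∈ P, l y < c)
    (hS : ∀ y ∈ S, l y = c) : ¬ IsSplitHyperplane P (affineSpan ℝ S) := by
  rintro ⟨C, hC, Q₁, Q₂, h₁, h₂, hne, hspan⟩
  obtain ⟨y, hy, hyc⟩ := hC.exists_inter_lt hP h₁ h₂ hne l hl hlt
  have : y ∈ affineSpan ℝ S := hspan ▸ subset_affineSpan ℝ _ hy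
  exact hyc.ne (eq_of_mem_affineSpan l.toLinearMap hS this)

end Polytopes

/-! ### Sums of coordinates -/

section CoordSum

variable {ι : Type*} [Finite ι]

/-- The linear functional that sums the coordinates indexed by a set. -/
noncomputable def coordSum (S : Set ι) : StrongDual ℝ (ι → ℝ) :=
  LinearMap.toContinuousLinearMap
    { toFun := fun x => ∑ᶠ i ∈ S, x i
      map_add' := fun _ _ => finsum_mem_add_distrib S.toFinite
      map_smul' := fun c x => by
        simp [finsum_mem_eq_finite_toFinset_sum _ S.toFinite, Finset.mul_sum] }

lemma coordSum_apply (S : Set ι) (x : ι → ℝ) : coordSum S x = ∑ᶠ i ∈ S, x i := rfl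

lemma coordSum_eq_sum (S : Set ι) (x : ι → ℝ) : coordSum S x = ∑ i ∈ S.toFinite.toFinset, x i :=
  finsum_mem_eq_finite_toFinset_sum _ S.toFinite

@[simp] lemma coordSum_empty (x : ι → ℝ) : coordSum ∅ x = 0 := by simp [coordSum_apply]

lemma coordSum_singleton (i : ι) (x : ι → ℝ) : coordSum {i} x = x i := by simp [coordSum_apply]

lemma coordSum_union_add_inter (S T : Set ι) (x : ι → ℝ) :
    coordSum (S ∪ T) x + coordSum (S ∩ T) x = coordSum S x + coordSum T x :=
  finsum_mem_union_inter S.toFinite T.toFinite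

lemma coordSum_charVec (S T : Set ι) : coordSum S (charVec T) = ((T ∩ S).ncard : ℝ) := by
  classical
  rw [coordSum_eq_sum, ncard_eq_toFinset_card _ (T ∩ S).toFinite]
  simp only [charVec, indicator_apply, Pi.one_apply, Finset.sum_boole]
  congr 2
  ext i
  simp [and_comm]

lemma coordSum_lt_ncard {S : Set ι} (hS : S.Nonempty) {x : ι → ℝ} (hx : ∀ i, x i < 1) :
    coordSum S x < S.ncard := by
  rw [coordSum_eq_sum, ncard_eq_toFinset_card _ S.toFinite, Finset.cast_card]
  exact Finset.sum_lt_sum_of_nonempty (by simpa using hS) fun i _ => hx i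

lemma coordSum_pos {S : Set ι} (hS : S.Nonempty) {x : ι → ℝ} (hx : ∀ i, 0 < x i) :
    0 < coordSum S x := by
  rw [coordSum_eq_sum]
  exact Finset.sum_pos (fun i _ => hx i) (by simpa using hS)

end CoordSum

/-! ### The matroid polytope and its supporting hyperplanes -/

section MatroidPolytope

variable {α : Type*} {M : Matroid α} {F X Y S : Set α}

instance [M.Finite] : Finite M.E := M.ground_finite

/-- The sum of the coordinates in a subset of the ground set. -/
noncomputable def setSum (M : Matroid α) [M.Finite] (X : Set α) : StrongDual ℝ (M.E → ℝ) :=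
  coordSum (Subtype.val ⁻¹' X)

lemma mem_hyperplane_iff [M.Finite] {x : M.E → ℝ} :
    x ∈ hyperplane M X ↔ setSum M X x = rk M X := Iff.rfl

lemma setSum_union_add_inter (M : Matroid α) [M.Finite] (X Y : Set α) (x : M.E → ℝ) :
    setSum M (X ∪ Y) x + setSum M (X ∩ Y) x = setSum M X x + setSum M Y x :=
  coordSum_union_add_inter _ _ x

@[simp] lemma setSum_empty [M.Finite] (x : M.E → ℝ) : setSum M ∅ x = 0 := coordSum_empty x

lemma setSum_add_setSum_diff [M.Finite] (hXY : X ⊆ Y) (x : M.E → ℝ) :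
    setSum M X x + setSum M (Y \ X) x = setSum M Y x := by
  have := setSum_union_add_inter M X (Y \ X) x
  rw [union_sdiff_cancel hXY, inter_sdiff_self, setSum_empty] at this
  linarith

/-- The vertex of the matroid polytope that belongs to a basis. -/
noncomputable def baseVec (M : Matroid α) (B : Set α) : M.E → ℝ :=
  charVec (Subtype.val ⁻¹' B)

lemma setSum_baseVec [M.Finite] {B : Set α} (hB : B ⊆ M.E) (X : Set α) :
    setSum M X (baseVec M B) = ((B ∩ X).ncard : ℝ) := by
  rw [setSum, baseVec, coordSum_charVec, ← preimage_inter,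
    ← ncard_image_of_injective _ Subtype.val_injective, Subtype.image_preimage_coe,
    inter_eq_self_of_subset_right (inter_subset_left.trans hB)]

lemma baseVec_mem_polytope {B : Set α} (hB : M.IsBase B) : baseVec M B ∈ polytope M := by
  refine subset_convexHull ℝ _ ⟨Subtype.val ⁻¹' B, ?_, rfl⟩
  rwa [mem_ofPred_eq, Subtype.image_preimage_coe, inter_eq_self_of_subset_right hB.subset_ground]

lemma polytope_subset {K : Set (M.E → ℝ)} (hK : Convex ℝ K)
    (h : ∀ B, M.IsBase B → baseVec M B ∈ K) : polytope M ⊆ K := by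
  refine convexHull_min ?_ hK
  rintro _ ⟨B, hB, rfl⟩
  have := h _ hB
  rwa [baseVec, preimage_image_eq _ Subtype.val_injective] at this

lemma setSum_le_rk [M.Finite] (X : Set α) {x : M.E → ℝ} (hx : x ∈ polytope M) :
    setSum M X x ≤ rk M X := by
  refine polytope_subset (K := {x | setSum M X x ≤ rk M X})
    (convex_halfSpace_le (setSum M X).toLinearMap.isLinear _) (fun B hB => ?_) hx
  rw [mem_ofPred_eq, setSum_baseVec hB.subset_ground]
  exact_mod_cast ncard_inter_le_rk hB X

lemma setSum_ground [M.Finite] {x : M.E → ℝ} (hx : x ∈ polytope M) :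
    setSum M M.E x = rk M M.E := by
  refine polytope_subset (K := {x | setSum M M.E x = rk M M.E})
    (convex_hyperplane (setSum M M.E).toLinearMap.isLinear _) (fun B hB => ?_) hx
  rw [mem_ofPred_eq, setSum_baseVec hB.subset_ground,
    inter_eq_self_of_subset_left hB.subset_ground, ncard_eq_rk_of_isBasis hB.isBasis_ground]

lemma polytope_subset_Icc (M : Matroid α) : polytope M ⊆ Icc 0 1 := by
  refine polytope_subset (convex_Icc 0 1) fun B _ => ⟨fun i => ?_, fun i => ?_⟩ <;>
  · by_cases h : (i : α) ∈ B <;> simp [baseVec, charVec, h]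

lemma isFace_hyperplane_inter [M.Finite] (X : Set α) :
    IsFace (polytope M) (hyperplane M X ∩ polytope M) := by
  have := isFace_of_forall_le (setSum M X) (rk M X) fun y hy => setSum_le_rk X hy
  rwa [inter_comm]

/-- A non-trivial set of elements of a connected matroid does not cut out the whole polytope. -/
lemma hyperplane_inter_ne_polytope [M.Finite] (hc : IsConnected M) (hS : S ⊆ M.E)
    (h₁ : S.Nonempty) (h₂ : (M.E \ S).Nonempty) : hyperplane M S ∩ polytope M ≠ polytope M := by
  intro heq
  obtain ⟨B, hB, h, -⟩ := exists_isBase_ncard_inter_eq (M := M) (X := M.E \ S) sdiff_subset subset_rfl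
  have hmem := baseVec_mem_polytope hB
  have hx := (heq.symm ▸ hmem : baseVec M B ∈ hyperplane M S ∩ polytope M).1
  have h3 := setSum_ground hmem
  rw [← setSum_add_setSum_diff hS, mem_hyperplane_iff.1 hx, setSum_baseVec hB.subset_ground,
    h] at h3
  have h4 := isConnected_iff.1 hc S hS h₁ h₂
  have h5 : rk M S + rk M (M.E \ S) = rk M M.E := by exact_mod_cast h3
  omega

/-- A hyperplane that contains the facet cut out by `F` cuts out the same facet. -/
lemma hyperplane_inter_eq_of_isFacet [M.Finite] (hc : IsConnected M)
    (hF : IsFacet (polytope M) (hyperplane M F ∩ polytope M)) (hS : S ⊆ M.E)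
    (h₁ : S.Nonempty) (h₂ : (M.E \ S).Nonempty)
    (hsub : hyperplane M F ∩ polytope M ⊆ hyperplane M S) :
    hyperplane M S ∩ polytope M = hyperplane M F ∩ polytope M := by
  by_contra hne
  refine hyperplane_inter_ne_polytope hc hS h₁ h₂ (hF.2.2 _ (isFace_hyperplane_inter S) ?_)
  exact (subset_inter hsub inter_subset_right).ssubset_of_ne (Ne.symm hne)

end MatroidPolytope

/-! ### Flacets have connected restriction and contraction -/

section Flacets

variable {α : Type*} {M : Matroid α} {F : Set α}

lemma IsFlacet.nonempty [M.Finite] (hF : IsFlacet M F) : F.Nonempty := by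
  rw [nonempty_iff_ne_empty]
  rintro rfl
  exact hF.2.1.2.1 (inter_eq_right.2 fun x _ => by simp [mem_hyperplane_iff])

lemma IsFlacet.ne_ground [M.Finite] (hF : IsFlacet M F) : F ≠ M.E := by
  rintro rfl
  exact hF.2.1.2.1 (inter_eq_right.2 fun x hx => mem_hyperplane_iff.2 (setSum_ground hx))

lemma IsFlacet.diff_nonempty [M.Finite] (hF : IsFlacet M F) : (M.E \ F).Nonempty :=
  sdiff_nonempty.2 fun h => hF.ne_ground (hF.1.subset_ground.antisymm h)

lemma IsConnected.indep_singleton (hc : IsConnected M) {e f : α} (he : e ∈ M.E) (hf : f ∈ M.E)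
    (hne : e ≠ f) : M.Indep {e} := by
  obtain ⟨C, hC, heC, hfC⟩ := hc e he f hf hne
  exact hC.ssubset_indep ((singleton_subset_iff.2 heC).ssubset_of_mem_notMem hfC hne.symm)

/-- If rank were additive over S and F \ S, then x(F) = r(F) would force x(S) = r(S) on P(M). So
H(S) cuts out the same facet, and S is a smaller flat, against minimality of F. -/
lemma IsFlacet.isConnected_restrict [M.Finite] (hc : IsConnected M) (hF : IsFlacet M F) :
    IsConnected (M.restrict F) := by
  have hFE := hF.1.subset_ground
  have : (M.restrict F).Finite := ⟨M.ground_finite.subset hFE⟩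
  rw [isConnected_iff]
  intro S hS hSne hTne
  rw [Matroid.restrict_ground_eq] at hS hTne ⊢
  rw [rk_restrict M subset_rfl, rk_restrict M hS, rk_restrict M sdiff_subset]
  by_contra! hle
  have hSE := hS.trans hFE
  have hsub : hyperplane M F ∩ polytope M ⊆ hyperplane M S := by
    rintro x ⟨hx, hxP⟩
    rw [mem_hyperplane_iff] at hx ⊢
    have h1 := setSum_add_setSum_diff hS x
    have h2 := setSum_le_rk S hxP
    have h3 := setSum_le_rk (F \ S) hxP
    have h4 : (rk M S : ℝ) + rk M (F \ S) ≤ rk M F := by exact_mod_cast hle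
    linarith
  have hES : (M.E \ S).Nonempty := hTne.mono (sdiff_subset_sdiff_left hFE)
  have heq := hyperplane_inter_eq_of_isFacet hc hF.2.1 hSE hSne hES hsub
  have hSflat : M.IsFlat S := by
    rw [Matroid.isFlat_iff_closure_eq]
    refine subset_antisymm (fun e he => by_contra fun heS => ?_) (M.subset_closure S hSE)
    have heF : e ∈ F := hF.1.closure ▸ M.closure_subset_closure hS he
    obtain ⟨s, hs⟩ := hSne
    have hi := hc.indep_singleton (hFE heF) (hSE hs) fun h => heS (h ▸ hs)
    have h1 : rk M (insert e S) ≤ rk M S := by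
      have h2 := M.eRk_mono (insert_subset he (M.subset_closure S hSE))
      rw [M.eRk_closure_eq, ← cast_rk, ← cast_rk] at h2
      exact_mod_cast h2
    -- A non-loop e of F \ S in the closure of S would give r(F) + 1 ≤ r(S) + r(F \ S).
    have h3 := rk_inter_add_rk_union_le M (insert e S) (F \ S)
    have h4 : rk M F ≤ rk M (insert e S ∪ (F \ S)) := rk_mono M fun y hy => by
      by_cases hyS : y ∈ S
      · exact Or.inl (Or.inr hyS)
      · exact Or.inr ⟨hy, hyS⟩
    have h5 : rk M {e} ≤ rk M (insert e S ∩ (F \ S)) :=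
      rk_mono M (singleton_subset_iff.2 ⟨Or.inl rfl, heF, heS⟩)
    rw [rk_eq_ncard_of_indep hi, ncard_singleton] at h5
    omega
  have := hF.2.2 S hSflat hS heq
  rw [this] at hTne
  simp at hTne

/-- A separation S, T of M/F makes both H(F ∪ S) and H(F ∪ T) cut out the facet of F. A base tight
on S and F ∪ S is then tight on F, so r(F ∪ S) = r(F) + r(S); likewise for T. Hence r(F) + r(E \ F)
≤ r(M), contradicting connectivity of M. -/
lemma IsFlacet.isConnected_dual_restrict [M.Finite] (hc : IsConnected M) (hF : IsFlacet M F) :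
    IsConnected (M.dual.restrict (M.E \ F)) := by
  have hFE := hF.1.subset_ground
  have : (M.dual.restrict (M.E \ F)).Finite := ⟨M.ground_finite.subset sdiff_subset⟩
  rw [isConnected_iff]
  intro S hS hSne hTne
  rw [Matroid.restrict_ground_eq] at hS hTne ⊢
  rw [rk_restrict _ subset_rfl, rk_restrict _ hS, rk_restrict _ sdiff_subset]
  by_contra! hle
  set T := (M.E \ F) \ S with hT
  have hTs : T ⊆ M.E \ F := sdiff_subset
  have hTS : (M.E \ F) \ T = S := sdiff_sdiff_cancel_left hS
  have hcompl : ∀ U ⊆ M.E \ F, M.E \ U = F ∪ ((M.E \ F) \ U) := by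
    intro U hU
    ext y
    have h1 := @hU y
    have h2 := @hFE y
    simp only [mem_sdiff, mem_union] at h1 ⊢
    tauto
  have h1 := rk_dual_add_rk_ground (M := M) (X := M.E \ F) sdiff_subset
  have h2 := rk_dual_add_rk_ground (M := M) (X := S) (hS.trans sdiff_subset)
  have h3 := rk_dual_add_rk_ground (M := M) (X := T) (hTs.trans sdiff_subset)
  rw [sdiff_sdiff_cancel_left hFE] at h1
  rw [hcompl S hS, ← hT] at h2
  rw [hcompl T hTs, hTS] at h3
  have hcard : T.ncard + S.ncard = (M.E \ F).ncard :=
    ncard_sdiff_add_ncard_of_subset hS (M.ground_finite.subset sdiff_subset)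
  have hle' : rk M (F ∪ S) + rk M (F ∪ T) ≤ rk M M.E + rk M F := by omega
  have hinter : (F ∪ S) ∩ (F ∪ T) = F := by
    rw [← union_inter_distrib_left, hT, inter_sdiff_self, union_empty]
  have hunion : (F ∪ S) ∪ (F ∪ T) = M.E := by
    rw [← union_union_distrib_left, hT, union_sdiff_cancel hS, union_sdiff_cancel hFE]
  have tight : ∀ U W : Set α, U ⊆ M.E \ F → U.Nonempty → W ⊆ M.E \ F → W.Nonempty →
      Disjoint U W → (F ∪ U) ∩ (F ∪ W) = F → (F ∪ U) ∪ (F ∪ W) = M.E →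
      rk M (F ∪ U) + rk M (F ∪ W) ≤ rk M M.E + rk M F → rk M F + rk M U ≤ rk M (F ∪ U) := by
    intro U W hU hUne hW hWne hdj hi hu hle
    have hFU : F ∪ U ⊆ M.E := union_subset hFE (hU.trans sdiff_subset)
    have hsub : hyperplane M F ∩ polytope M ⊆ hyperplane M (F ∪ U) := by
      rintro x ⟨hx, hxP⟩
      rw [mem_hyperplane_iff] at hx ⊢
      have h1 := setSum_union_add_inter M (F ∪ U) (F ∪ W) x
      rw [hi, hu, setSum_ground hxP, hx] at h1
      have h2 := setSum_le_rk (F ∪ U) hxP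
      have h3 := setSum_le_rk (F ∪ W) hxP
      have h4 : (rk M (F ∪ U) : ℝ) + rk M (F ∪ W) ≤ rk M M.E + rk M F := by exact_mod_cast hle
      linarith
    have hne : (M.E \ (F ∪ U)).Nonempty := by
      obtain ⟨w, hw⟩ := hWne
      exact ⟨w, (hW hw).1, fun h => h.elim (hW hw).2 fun h => disjoint_left.1 hdj h hw⟩
    have heq := hyperplane_inter_eq_of_isFacet hc hF.2.1 hFU (hUne.mono subset_union_right) hne hsub
    obtain ⟨B, hB, hBU, hBFU⟩ :=
      exists_isBase_ncard_inter_eq (M := M) (subset_union_right : U ⊆ F ∪ U) hFU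
    have hx : baseVec M B ∈ hyperplane M (F ∪ U) ∩ polytope M := by
      refine ⟨?_, baseVec_mem_polytope hB⟩
      rw [mem_hyperplane_iff, setSum_baseVec hB.subset_ground, hBFU]
    rw [heq] at hx
    have hBF := mem_hyperplane_iff.1 hx.1
    rw [setSum_baseVec hB.subset_ground] at hBF
    have hBF' : (B ∩ F).ncard = rk M F := by exact_mod_cast hBF
    have hfin : ∀ Z : Set α, (B ∩ Z).Finite := fun Z =>
      M.ground_finite.subset (inter_subset_left.trans hB.subset_ground)
    rw [← hBF', ← hBU, ← hBFU, inter_union_distrib_left, ncard_union_eq _ (hfin F) (hfin U)]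
    exact (disjoint_sdiff_right.mono_right hU).mono inter_subset_right inter_subset_right
  have hdj : Disjoint S T := disjoint_sdiff_right
  have hS' := tight S T hS hSne hTs hTne hdj hinter hunion hle'
  have hT' := tight T S hTs hTne hS hSne hdj.symm (by rwa [inter_comm]) (by rwa [union_comm])
    (by omega)
  have h4 := isConnected_iff.1 hc F hFE hF.nonempty hF.diff_nonempty
  have h5 := rk_union_le M S T
  rw [hT, union_sdiff_cancel hS, ← hT] at h5
  omega

end Flacets

/-! ### Split flacets and the counting argument -/

section SplitFlacets

variable {α : Type*} {M : Matroid α} {F F₁ F₂ : Set α}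

lemma isPolytope_hypersimplex (ι : Type*) [Finite ι] (r : ℕ) : IsPolytope (hypersimplex ι r) :=
  ⟨_, (toFinite _).image _, rfl⟩

lemma IsConnected.exists_isBase_notMem (hc : IsConnected M) {e f : α} (he : e ∈ M.E)
    (hf : f ∈ M.E) (hne : e ≠ f) : ∃ B, M.IsBase B ∧ e ∉ B := by
  obtain ⟨C, hC, heC, -⟩ := hc e he f hf hne
  have := hC.not_isColoop_of_mem heC
  rw [Matroid.isColoop_iff_forall_mem_isBase] at this
  push Not at this
  exact this

lemma IsConnected.exists_isBase_mem (hc : IsConnected M) {e f : α} (he : e ∈ M.E)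
    (hf : f ∈ M.E) (hne : e ≠ f) : ∃ B, M.IsBase B ∧ e ∈ B := by
  obtain ⟨B, hB, h⟩ := (hc.indep_singleton he hf hne).exists_isBase_superset
  exact ⟨B, hB, h rfl⟩

lemma baseVec_apply_of_mem {B : Set α} {i : M.E} (h : (i : α) ∈ B) : baseVec M B i = 1 := by
  simp [baseVec, charVec, h]

lemma baseVec_apply_of_notMem {B : Set α} {i : M.E} (h : (i : α) ∉ B) : baseVec M B i = 0 := by
  simp [baseVec, charVec, h]

lemma polytope_subset_hypersimplex [M.Finite] : polytope M ⊆ hypersimplex M.E (rk M M.E) := by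
  refine convexHull_mono (image_mono fun B hB => ?_)
  rw [mem_ofPred_eq, ← Subtype.val_injective.encard_image, hB.encard_eq_eRank, ← M.eRk_ground,
    cast_rk]

/-- For F = {e} the hyperplane is x_e = 1, which supports the hypersimplex and so cannot split it.
-/
lemma IsSplitFlacet.nontrivial [M.Finite] (hc : IsConnected M) (hF : IsSplitFlacet M F) :
    F.Nontrivial := by
  by_contra hnt
  obtain ⟨e, rfl⟩ := hF.1.nonempty.exists_eq_singleton_or_nontrivial.resolve_right hnt
  have he : e ∈ M.E := hF.1.1.subset_ground rfl
  obtain ⟨f, hf, hfe⟩ := hF.1.diff_nonempty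
  have hne : e ≠ f := fun h => hfe h.symm
  have hrk : rk M {e} = 1 := by
    rw [rk_eq_ncard_of_indep (hc.indep_singleton he hf hne), ncard_singleton]
  refine not_isSplitHyperplane_affineSpan (isPolytope_hypersimplex M.E (rk M M.E))
    (coordSum {(⟨e, he⟩ : M.E)}) (c := 1) (fun y hy => ?_) ?_ (fun y hy => ?_) hF.2
  · refine convexHull_min (t := {y : M.E → ℝ | coordSum {(⟨e, he⟩ : M.E)} y ≤ 1}) ?_
      (convex_halfSpace_le (coordSum {(⟨e, he⟩ : M.E)}).toLinearMap.isLinear _) hy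
    rintro _ ⟨S, -, rfl⟩
    rw [mem_ofPred_eq, coordSum_singleton]
    exact indicator_le_self' (fun _ _ => zero_le_one) _
  · obtain ⟨B, hB, heB⟩ := hc.exists_isBase_notMem he hf hne
    refine ⟨baseVec M B, polytope_subset_hypersimplex (baseVec_mem_polytope hB), ?_⟩
    rw [coordSum_singleton, baseVec_apply_of_notMem heB]
    exact zero_lt_one
  · have h1 := mem_hyperplane_iff.1 hy.1
    rw [hrk, Nat.cast_one] at h1
    rw [← h1, setSum]
    congr 2
    ext i
    simp [Subtype.ext_iff]

lemma IsFlacet.isProperCyclicFlat [M.Finite] (hc : IsConnected M) (hF : IsFlacet M F)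
    (hnt : F.Nontrivial) : IsProperCyclicFlat M F :=
  isProperCyclicFlat_of_isConnected_restrict hF.1 hF.ne_ground (hF.isConnected_restrict hc) hnt

lemma IsFlacet.isProperCyclicFlat_dual [M.Finite] (hc : IsConnected M) (hF : IsFlacet M F)
    (hnt : F.Nontrivial) : IsProperCyclicFlat M.dual (M.E \ F) := by
  have hFE := hF.1.subset_ground
  refine isProperCyclicFlat_of_isConnected_restrict (isFlat_dual_compl fun e he => ?_) ?_
    (hF.isConnected_dual_restrict hc) ?_
  · obtain ⟨C, hCF, hC, heC, -⟩ := exists_isCircuit_subset_of_isConnected_restrict hFE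
      (hF.isConnected_restrict hc) hnt he
    exact ⟨C, hCF, hC, heC⟩
  · intro h
    obtain ⟨e, he⟩ := hF.nonempty
    exact ((h.symm ▸ hFE he : e ∈ M.E \ F)).2 he
  -- If E \ F = {e}, a circuit through e puts e in the closure of F, which is F.
  · by_contra hn
    obtain ⟨e, he⟩ := hF.diff_nonempty.exists_eq_singleton_or_nontrivial.resolve_right hn
    have heE : e ∈ M.E \ F := he ▸ rfl
    obtain ⟨f, hf⟩ := hF.nonempty
    obtain ⟨C, hC, heC, -⟩ := hc e heE.1 f (hFE hf) fun h => heE.2 (h ▸ hf)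
    have hCF : C \ {e} ⊆ F := fun y hy => by_contra fun hyF =>
      hy.2 (he ▸ ⟨hC.subset_ground hy.1, hyF⟩ : y ∈ ({e} : Set α))
    refine heE.2 (hF.1.closure ▸ M.closure_subset_closure hCF ?_)
    exact hC.mem_closure_sdiff_singleton_of_mem heC

/-- The relative interior of the hypersimplex, in the form used in the definition of split
matroids, has no point with a coordinate `0` or `1`. -/
lemma IsConnected.pos_and_lt_one_of_mem_relInterior [M.Finite] (hc : IsConnected M)
    (hnt : M.E.Nontrivial) {x : M.E → ℝ}
    (hx : x ∈ relInterior ((affineSpan ℝ (polytope M) : Set (M.E → ℝ)) ∩ Icc 0 1)) (i : M.E) :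
    0 < x i ∧ x i < 1 := by
  obtain ⟨f, hf, hne⟩ := hnt.exists_ne i
  have hmem : ∀ B, M.IsBase B →
      baseVec M B ∈ (affineSpan ℝ (polytope M) : Set (M.E → ℝ)) ∩ Icc 0 1 := fun B hB =>
    ⟨subset_affineSpan ℝ _ (baseVec_mem_polytope hB), polytope_subset_Icc M (baseVec_mem_polytope hB)⟩
  constructor
  · refine lt_of_le_of_ne (hx.1.2.1 i) fun h => ?_
    -- If x_i = 0, the face x_i = 0 contains x and must be everything, but some base contains i. The
    -- other bound uses a base avoiding i.
    have hface := isFace_of_forall_le (P := (affineSpan ℝ (polytope M) : Set (M.E → ℝ)) ∩ Icc 0 1)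
      (-coordSum {i}) 0 fun y hy => by
        simpa [coordSum_singleton] using hy.2.1 i
    have heq := hx.2 _ hface ⟨hx.1, by simpa [coordSum_singleton] using h.symm⟩
    obtain ⟨B, hB, hiB⟩ := hc.exists_isBase_mem i.2 hf hne.symm
    have := (heq.symm ▸ hmem B hB : baseVec M B ∈ {y | _ ∧ _}).2
    simp [coordSum_singleton, baseVec_apply_of_mem hiB] at this
  · refine lt_of_le_of_ne (hx.1.2.2 i) fun h => ?_
    have hface := isFace_of_forall_le (P := (affineSpan ℝ (polytope M) : Set (M.E → ℝ)) ∩ Icc 0 1)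
      (coordSum {i}) 1 fun y hy => by
        simpa [coordSum_singleton] using hy.2.2 i
    have heq := hx.2 _ hface ⟨hx.1, by simpa [coordSum_singleton] using h⟩
    obtain ⟨B, hB, hiB⟩ := hc.exists_isBase_notMem i.2 hf hne.symm
    have := (heq.symm ▸ hmem B hB : baseVec M B ∈ {y | _ ∧ _}).2
    simp [coordSum_singleton, baseVec_apply_of_notMem hiB] at this

lemma setSum_lt_ncard [M.Finite] {X : Set α} (hX : X ⊆ M.E) (hne : X.Nonempty) {x : M.E → ℝ}
    (hx : ∀ i, x i < 1) : setSum M X x < X.ncard := by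
  have h : (Subtype.val ⁻¹' X : Set M.E).ncard = X.ncard := by
    rw [← ncard_image_of_injective _ Subtype.val_injective, Subtype.image_preimage_coe,
      inter_eq_self_of_subset_right hX]
  obtain ⟨e, he⟩ := hne
  rw [← h]
  exact coordSum_lt_ncard ⟨⟨e, hX he⟩, he⟩ hx

lemma setSum_pos [M.Finite] {X : Set α} (hX : X ⊆ M.E) (hne : X.Nonempty) {x : M.E → ℝ}
    (hx : ∀ i, 0 < x i) : 0 < setSum M X x := by
  obtain ⟨e, he⟩ := hne
  exact coordSum_pos ⟨⟨e, hX he⟩, he⟩ hx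

/-- Two incomparable flats whose restrictions are uniform, the first of them with a uniform
contraction: their hyperplanes do not meet inside the open cube. -/
lemma false_of_isUniform_of_not_subset [M.Finite] (hc : IsConnected M) (h₁ : M.IsFlat F₁)
    (h₂ : M.IsFlat F₂) (hne₁ : F₁.Nonempty) (hE₁ : (M.E \ F₁).Nonempty)
    (hd₂ : rk M F₂ < F₂.ncard) (hu₁ : IsUniform (M.restrict F₁))
    (hu₁' : IsUniform (M.dual.restrict (M.E \ F₁))) (hsub : ¬ F₁ ⊆ F₂) {x : M.E → ℝ}
    (hx : ∀ i, 0 < x i ∧ x i < 1) (hxE : setSum M M.E x = rk M M.E)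
    (hx₁ : setSum M F₁ x = rk M F₁) (hx₂ : setSum M F₂ x = rk M F₂) : False := by
  have hE := h₁.subset_ground
  have hE' := h₂.subset_ground
  have hIE : F₁ ∩ F₂ ⊆ M.E := inter_subset_left.trans hE
  have hUE : F₁ ∪ F₂ ⊆ M.E := union_subset hE hE'
  have hlt : rk M (F₁ ∩ F₂) < rk M F₁ := by
    by_contra! h
    exact hsub (subset_of_rk_le h₂ inter_subset_right inter_subset_left hE h)
  have hI := rk_eq_min_of_isUniform hE hu₁ (inter_subset_left : F₁ ∩ F₂ ⊆ F₁)
  have hIa : rk M (F₁ ∩ F₂) = (F₁ ∩ F₂).ncard := by omega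
  have hU := rk_eq_min_of_isUniform (M := M.dual) (X := M.E \ (F₁ ∪ F₂)) (Y := M.E \ F₁)
    sdiff_subset hu₁'
    (sdiff_subset_sdiff_right subset_union_left)
  have hd1 := rk_dual_add_rk_ground (M := M) (X := M.E \ (F₁ ∪ F₂)) sdiff_subset
  have hd2 := rk_dual_add_rk_ground (M := M) (X := M.E \ F₁) sdiff_subset
  rw [sdiff_sdiff_cancel_left hUE] at hd1
  rw [sdiff_sdiff_cancel_left hE] at hd2
  have hfin := M.ground_finite
  have hc1 := ncard_sdiff_add_ncard_of_subset hUE hfin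
  have hc2 := ncard_sdiff_add_ncard_of_subset hE hfin
  have hc3 := ncard_union_add_ncard_inter F₁ F₂ (hfin.subset hE) (hfin.subset hE')
  have hsm := rk_inter_add_rk_union_le M F₁ F₂
  -- The other value of the minimum in `hU` would mean r(F₁ ∪ F₂) = r(F₁) + |F₂ \ F₁|. Submodularity
  -- and independence of F₁ ∩ F₂ would then give r(F₂) ≥ |F₂|.
  have hrU : rk M (F₁ ∪ F₂) = rk M M.E := by omega
  have hle : ((F₁ ∩ F₂).ncard : ℝ) + rk M M.E ≤ rk M F₁ + rk M F₂ := by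
    have : (F₁ ∩ F₂).ncard + rk M M.E ≤ rk M F₁ + rk M F₂ := by omega
    exact_mod_cast this
  have hs1 := setSum_union_add_inter M F₁ F₂ x
  have hs2 := setSum_add_setSum_diff hUE x
  rcases (F₁ ∩ F₂).eq_empty_or_nonempty with h0 | h0
  · rw [h0, setSum_empty] at hs1
    have hn : (0 : ℝ) ≤ (F₁ ∩ F₂).ncard := Nat.cast_nonneg _
    rcases (M.E \ (F₁ ∪ F₂)).eq_empty_or_nonempty with h1 | h1
    · rw [h1, setSum_empty] at hs2
      have hF₂ : M.E \ F₁ = F₂ := by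
        refine subset_antisymm (fun y hy => ?_) fun y hy => ⟨hE' hy, fun h =>
          eq_empty_iff_forall_notMem.1 h0 y ⟨h, hy⟩⟩
        by_contra hy₂
        exact eq_empty_iff_forall_notMem.1 h1 y ⟨hy.1, fun h => h.elim hy.2 hy₂⟩
      have h3 := isConnected_iff.1 hc F₁ hE hne₁ hE₁
      rw [hF₂] at h3
      have h4 : (rk M M.E : ℝ) < rk M F₁ + rk M F₂ := by exact_mod_cast h3
      linarith
    · have := setSum_pos sdiff_subset h1 fun i => (hx i).1
      linarith
  · have hI' := setSum_lt_ncard hIE h0 fun i => (hx i).2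
    rcases (M.E \ (F₁ ∪ F₂)).eq_empty_or_nonempty with h1 | h1
    · rw [h1, setSum_empty] at hs2
      linarith
    · have := setSum_pos sdiff_subset h1 fun i => (hx i).1
      linarith

lemma IsFlacet.rk_lt_ncard [M.Finite] (hc : IsConnected M) (hF : IsFlacet M F)
    (hnt : F.Nontrivial) : rk M F < F.ncard := by
  have hFE := hF.1.subset_ground
  obtain ⟨e, he⟩ := hF.nonempty
  obtain ⟨C, hCF, hC, -, -⟩ := exists_isCircuit_subset_of_isConnected_restrict hFE
    (hF.isConnected_restrict hc) hnt he
  by_contra! h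
  exact hC.not_indep ((indep_of_ncard_le_rk hFE h).subset hCF)

/-- A flat with a uniform restriction does not properly contain a flat that is dependent. -/
lemma eq_of_subset_of_isUniform [M.Finite] (h₁ : M.IsFlat F₁) (h₂ : M.IsFlat F₂)
    (hd₁ : rk M F₁ < F₁.ncard) (hu₂ : IsUniform (M.restrict F₂)) (hsub : F₁ ⊆ F₂) : F₁ = F₂ := by
  have := rk_eq_min_of_isUniform h₂.subset_ground hu₂ hsub
  exact hsub.antisymm (subset_of_rk_le h₁ subset_rfl hsub h₂.subset_ground (by omega))

end SplitFlacets

end SplitMatroid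

theorem mainTheorem4 {α : Type*} (M : Matroid α) [M.Finite]
    (hconn : SplitMatroid.IsConnected M) (hsplit : ¬ SplitMatroid.IsSplit M) :
    ∃ M' : Matroid α, (M' = M ∨ M' = M.dual) ∧
      ∃ Z : Set α, SplitMatroid.IsProperCyclicFlat M' Z ∧
        SplitMatroid.IsConnected (M'.restrict Z) ∧
        ¬ SplitMatroid.IsUniform (M'.restrict Z) := by
  open SplitMatroid in
  unfold IsSplit at hsplit
  push Not at hsplit
  obtain ⟨F₁, F₂, h₁, h₂, hne, x, hx, hxi⟩ := hsplit
  have hnt₁ := h₁.nontrivial hconn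
  have hnt₂ := h₂.nontrivial hconn
  by_contra! hcon
  have hu : ∀ F, IsSplitFlacet M F → IsUniform (M.restrict F) ∧
      IsUniform (M.dual.restrict (M.E \ F)) := fun F hF =>
    have hnt := hF.nontrivial hconn
    ⟨hcon M (Or.inl rfl) F (hF.1.isProperCyclicFlat hconn hnt) (hF.1.isConnected_restrict hconn),
      hcon M.dual (Or.inr rfl) _ (hF.1.isProperCyclicFlat_dual hconn hnt)
        (hF.1.isConnected_dual_restrict hconn)⟩
  have hd₁ := h₁.1.rk_lt_ncard hconn hnt₁
  have hd₂ := h₂.1.rk_lt_ncard hconn hnt₂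
  refine false_of_isUniform_of_not_subset hconn h₁.1.1 h₂.1.1 h₁.1.nonempty h₁.1.diff_nonempty hd₂
    (hu F₁ h₁).1 (hu F₁ h₁).2
    (fun h => hne (eq_of_subset_of_isUniform h₁.1.1 h₂.1.1 hd₁ (hu F₂ h₂).1 h))
    (hconn.pos_and_lt_one_of_mem_relInterior (hnt₁.mono h₁.1.1.subset_ground) hxi) ?_ hx.1 hx.2
  -- The equation x(E) = r(M) passes from P(M) to its affine span, which contains x.
  exact eq_of_mem_affineSpan (setSum M M.E).toLinearMap (fun y hy => setSum_ground hy) hxi.1.1
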